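/- Let $m,n\ge 2$, $X=\{1,\dots,m\}\times\{1,\dots,n\}$ and $\mathcal P=\{C_1,\dots,C_m\}$ with $C_i=\{i\}\times\{1,\dots,n\}$. For a set $Y$ let $\mathcal T_Y$ be the monoid of all maps $Y\to Y$ under composition and $\mathcal E_Y$ its submonoid generated by all idempotents; write $\mathcal T_k,\mathcal E_k$ if $Y=\{1,\dots,k\}$, and let $\mathcal S_k$ be the symmetric group. Let $\mathcal T(X,\mathcal P)$ be the monoid of all $f\in\mathcal T_X$ that map each $C_i$ into some $C_j$, and let $S=\mathcal E(X,\mathcal P)$ be its submonoid generated by all idempotents of $\mathcal T(X,\mathcal P)$. The rank $\operatorname{rank}(M)$ (respectively the idempotent rank $\operatorname{idrank}(M)$) of a monoid $M$ is the least cardinality of a set of elements (respectively of idempotents) that generates $M$ as a monoid. A minimal idempotent generating set of $M$ is a generating set of $M$ consisting of idempotents that has the least cardinality among all such sets. For $g_1,\dots,g_m\in\mathcal T_n$ and $h\in\mathcal T_m$ let $[g_1,\dots,g_m;h]\in\mathcal T(X,\mathcal P)$ be the map sending $(i,x)$ to $(h(i),g_i(x))$. For $g\in\mathcal T_n$ let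 $g^{(i)}=[1,\dots,1,g,1,\dots,1;1]$ with $g$ in position $i$, and put $U^{(i)}=\{g^{(i)}:g\in U\}$ for $U\subseteq\mathcal T_n$. For $i\ne j$ in $\{1,\dots,m\}$ let $e_{ij}\in\mathcal T_m$ map $j$ to $i$ and fix all other points, and for $f\in\mathcal S_n$ let $e_{ij;f}=[1,\dots,1,f,1,\dots,1;e_{ij}]$ with $f$ in position $j$. Let $U_1,\dots,U_m$ be minimal idempotent generating sets of $\mathcal E_n$. Let $V$ be a set of idempotents of $\mathcal T_m$ with image of size $m-1$ that generates $\mathcal T_m\setminus\mathcal S_m$ as a semigroup. Let $\Xi_V$ be the set of pairs $(i,j)$ with $i<j$ and $e_{ij},e_{ji}\in V$, and $\Phi_V$ the set of pairs $(i,j)$ with $i\ne j$, $e_{ij}\in V$ and $e_{ji}\notin V$. For each $(i,j)\in\Xi_V$ let $A_{ij},B_{ij}$ be non-empty disjoint sets with $A_{ij}\cup B_{ij}=\mathcal S_n$. Put $$W=\bigcup_{(i,j)\in\Phi_V}\{e_{ij;f}:f\in\mathcal S_n\}\ \cup\bigcup_{(i,j)\in\Xi_V}\Big(\{e_{ij;f}:f\in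 A_{ij}\}\cup\{e_{ji;f^{-1}}:f\in B_{ij}\}\Big).$$ Then $U_1^{(1)}\cup\dots\cup U_m^{(m)}\cup W$ is an idempotent generating set of the monoid $S$, of size $m\rho_n+n!\binom m2$, where $\rho_2=2$ and $\rho_n=\binom n2$ for $n\ge3$. Consequently (for all $m,n\ge2$) $$\operatorname{rank}(S)=\operatorname{idrank}(S)=m\rho_n+n!\binom m2 .$$ -/

import Mathlib

namespace BlockTransf

open Function

/-! Transformations of a set `X` are the elements of Mathlib's monoid `Function.End X` of all maps
`X → X` under composition. The submonoid (or subsemigroup) that a set of transformations generates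
consists of all finite products, so as a set it is the same whether maps are composed from left to
right or from right to left; idempotents and ranks do not depend on this order either. -/

/-- `U` is a generating set of the monoid `S` (a submonoid of `T`): `U ⊆ S` and every element of `S`
is a (possibly empty) product of elements of `U`. -/
def IsGenSet {T : Type*} [Monoid T] (S : Submonoid T) (U : Set T) : Prop :=
  Submonoid.closure U = S

/-- `U` is a generating set of `S` that consists of idempotents. -/
def IsIdemGenSet {T : Type*} [Monoid T] (S : Submonoid T) (U : Set T) : Prop :=
  (∀ u ∈ U, IsIdempotentElem u) ∧ IsGenSet S U

/-- A minimal idempotent generating set: an idempotent generating set of least cardinality. -/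
def IsMinIdemGenSet {T : Type*} [Monoid T] (S : Submonoid T) (U : Set T) : Prop :=
  IsIdemGenSet S U ∧ ∀ U' : Set T, IsIdemGenSet S U' → U.encard ≤ U'.encard

/-- The rank of `S`: the least cardinality of a generating set (`⊤` if it is infinite). -/
noncomputable def rank {T : Type*} [Monoid T] (S : Submonoid T) : ℕ∞ :=
  ⨅ (U : Set T) (_ : IsGenSet S U), U.encard

/-- The idempotent rank of `S`: the least cardinality of an idempotent generating set
(`⊤` if there is none, or if it is infinite). -/
noncomputable def idrank {T : Type*} [Monoid T] (S : Submonoid T) : ℕ∞ :=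
  ⨅ (U : Set T) (_ : IsIdemGenSet S U), U.encard

/-- The monoid of all transformations of `X` that map every member of the family `P` of subsets
of `X` into some member of `P`. -/
def preserving {X : Type*} (P : Set (Set X)) : Submonoid (Function.End X) where
  carrier := {f | ∀ C ∈ P, ∃ D ∈ P, ∀ x ∈ C, f x ∈ D}
  one_mem' := fun C hC => ⟨C, hC, fun _ hx => hx⟩
  mul_mem' := by
    intro f g hf hg C hC
    obtain ⟨D, hD, hCD⟩ := hg C hC
    obtain ⟨F, hF, hDF⟩ := hf D hD
    exact ⟨F, hF, fun x hx => hDF _ (hCD x hx)⟩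

/-- The monoid `𝓔(X, P)` generated by all idempotent transformations of `X` preserving `P`. -/
def idemGenPreserving {X : Type*} (P : Set (Set X)) : Submonoid (Function.End X) :=
  Submonoid.closure {f | f ∈ preserving P ∧ IsIdempotentElem f}

/-- The monoid `𝓔_X` generated by all idempotent transformations of `X`. -/
def idemGen (X : Type*) : Submonoid (Function.End X) :=
  Submonoid.closure {f | IsIdempotentElem f}

/-- The partition of `{1, …, m} × {1, …, n}` into the `m` blocks `C_i = {i} × {1, …, n}`. -/
def blocks (m n : ℕ) : Set (Set (Fin m × Fin n)) :=
  Set.range fun i : Fin m => {p | p.1 = i}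

/-- The transformation `[g_1, …, g_m; h]`, which maps `(i, x)` to `(h i, g_i x)`. -/
def wr {m n : ℕ} (g : Fin m → Function.End (Fin n)) (h : Function.End (Fin m)) :
    Function.End (Fin m × Fin n) :=
  fun p => (h p.1, g p.1 p.2)

/-- The transformation `e_{ij}`, which maps `j` to `i` and fixes all other points. -/
def e {m : ℕ} (i j : Fin m) : Function.End (Fin m) :=
  fun k => if k = j then i else k

/-- The transformation `e_{ij;f} = [1, …, 1, f, 1, …, 1; e_{ij}]`, with `f` in position `j`. -/
def eBlock {m n : ℕ} (i j : Fin m) (f : Equiv.Perm (Fin n)) : Function.End (Fin m × Fin n) :=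
  wr (fun k => if k = j then (f : Fin n → Fin n) else (1 : Function.End (Fin n))) (e i j)

/-- The transformation `g^{(i)} = [1, …, 1, g, 1, …, 1; 1]`, with `g` in position `i`. -/
def inBlock {m n : ℕ} (i : Fin m) (g : Function.End (Fin n)) : Function.End (Fin m × Fin n) :=
  wr (fun k => if k = i then g else 1) 1

/-- The idempotent transformations of `{1, …, m}` whose image has exactly `m - 1` elements. -/
def idemCorankOne (m : ℕ) : Set (Function.End (Fin m)) :=
  {f | IsIdempotentElem f ∧ (Set.range (f : Fin m → Fin m)).ncard + 1 = m}

/-- The transformations of `{1, …, m}` that are not permutations. -/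
def singular (m : ℕ) : Set (Function.End (Fin m)) :=
  {f | ¬ Bijective (f : Fin m → Fin m)}

/-- `Ξ_V`: the pairs `i < j` such that both `e_{ij}` and `e_{ji}` lie in `V`. -/
def Xi {m : ℕ} (V : Set (Function.End (Fin m))) : Set (Fin m × Fin m) :=
  {p | p.1 < p.2 ∧ e p.1 p.2 ∈ V ∧ e p.2 p.1 ∈ V}

/-- `Φ_V`: the pairs `i ≠ j` such that `e_{ij}` lies in `V` but `e_{ji}` does not. -/
def Phi {m : ℕ} (V : Set (Function.End (Fin m))) : Set (Fin m × Fin m) :=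
  {p | p.1 ≠ p.2 ∧ e p.1 p.2 ∈ V ∧ e p.2 p.1 ∉ V}

/-- The set `W` determined by `V` and the subsets `A_{ij}`, `B_{ij}` of the symmetric group. -/
def setW {m n : ℕ} (V : Set (Function.End (Fin m)))
    (A B : Fin m → Fin m → Set (Equiv.Perm (Fin n))) : Set (Function.End (Fin m × Fin n)) :=
  (⋃ p ∈ Phi V, {x | ∃ f : Equiv.Perm (Fin n), x = eBlock p.1 p.2 f}) ∪
  ⋃ p ∈ Xi V, ({x | ∃ f ∈ A p.1 p.2, x = eBlock p.1 p.2 f} ∪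
    {x | ∃ f ∈ B p.1 p.2, x = eBlock p.2 p.1 f⁻¹})

/-- `ρ_2 = 2` and `ρ_n = n(n-1)/2` for `n ≥ 3`. -/
def rho (n : ℕ) : ℕ := if n = 2 then 2 else n.choose 2

end BlockTransf

namespace BlockTransf

open Function

/-! ### Singular transformations are products of the idempotents `e i j` -/

/-! Products are read right to left, so the kernel of the rightmost factor lies inside the kernel of
the product.

Lower bound (`IsGenSet.le_encard`). An element of `S` whose base map is a bijection has base map 1
and components that are singular or 1 (`exists_wr_of_mem`), so `S` has no units but 1. For each pair
`a < b` and each block `i`, the last nontrivial factor of `inBlock i (e a b)` lies in block `i` and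
has kernel pair `{a, b}`. This gives `n.choose 2` generators per block. When `n = 2` the first
factor must already be the constant map itself, so both constants are needed. For each pair `i < j`
and each permutation `f`, the last nontrivial factor of `eBlock i j f` has bijective components and
a base map whose only merged pair is `{i, j}`. Its components satisfy `g j = g i ∘ f`, so `i`, `j`
and `f` can be read off from it. Singular base maps separate this family from the first.

Generation. Powers of `eBlock i j a * eBlock j i f⁻¹` yield `eBlock i j f`, so each kernel needs to
occur in `W` in only one orientation, provided that both orientations occur for some permutation
(`eBlock_mem_of_cover`). If `V` contains only one arc of a pair, the opposite maps come from
`eBlock_eq_mul`, since `V` generates every `e i j`. All `eBlock i j f` together with the copies of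
`idemGen (Fin n)` then give every `wr g h` with `h` singular (`wr_mem_of_singular`), hence every
idempotent of `S`.

For the size, `W` is parametrised by the pairs `i < j` and the permutations, and a reversed-arc
tournament bounds each `U i` by `rho n`. Only these upper bounds are proved directly; equality
follows from the lower bound. -/

theorem e_apply_self {m : ℕ} (i j : Fin m) : e i j j = i := by simp [e]

theorem e_apply_of_ne {m : ℕ} {i j k : Fin m} (h : k ≠ j) : e i j k = k := by simp [e, h]

theorem mul_apply {α : Type*} (f g : Function.End α) (x : α) : (f * g) x = f (g x) := rfl

theorem one_apply {α : Type*} (x : α) : (1 : Function.End α) x = x := rfl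

/-- A permutation, seen as a transformation. -/
def ofPerm {α : Type*} (f : Equiv.Perm α) : Function.End α := (f : α → α)

theorem ofPerm_apply {α : Type*} (f : Equiv.Perm α) (x : α) : ofPerm f x = f x := rfl

theorem e_idem {m : ℕ} {i j : Fin m} (h : i ≠ j) : IsIdempotentElem (e i j) := by
  funext k
  by_cases hk : k = j
  · subst hk
    rw [mul_apply, e_apply_self, e_apply_of_ne h]
  · rw [mul_apply, e_apply_of_ne hk, e_apply_of_ne hk]

theorem e_mem_singular {m : ℕ} {i j : Fin m} (h : i ≠ j) : e i j ∈ singular m := by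
  intro hb
  exact h (hb.1 (by rw [e_apply_self, e_apply_of_ne h]))

/-- The idempotents `e i j` with `i ≠ j`. -/
def elemIdem (m : ℕ) : Set (Function.End (Fin m)) :=
  {v | ∃ i j, i ≠ j ∧ v = e i j}

theorem e_mem_closure_elemIdem {m : ℕ} (i j : Fin m) (h : i ≠ j) :
    e i j ∈ Subsemigroup.closure (elemIdem m) :=
  Subsemigroup.subset_closure ⟨i, j, h, rfl⟩

/-- The image of `e a b` misses `b`. If `b` is one of the swapped points, moving the other one onto
it acts as the swap on that image. Otherwise `b` serves as a free slot for exchanging `i` and `j` in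
three moves. -/
theorem swap_mul_e_mem {m : ℕ} {M : Subsemigroup (Function.End (Fin m))}
    (hM : ∀ i j, i ≠ j → e i j ∈ M) {i j a b : Fin m} (hij : i ≠ j) (hab : a ≠ b) :
    ofPerm (Equiv.swap i j) * e a b ∈ M := by
  by_cases hj : b = j
  · subst hj
    have : ofPerm (Equiv.swap i b) * e a b = e b i * e a b := by
      funext k
      simp only [mul_apply, e, ofPerm_apply, Equiv.swap_apply_def]
      grind
    rw [this]
    exact M.mul_mem (hM _ _ hij.symm) (hM _ _ hab)
  by_cases hi : b = i
  · subst hi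
    have : ofPerm (Equiv.swap b j) * e a b = e b j * e a b := by
      funext k
      simp only [mul_apply, e, ofPerm_apply, Equiv.swap_apply_def]
      grind
    rw [this]
    exact M.mul_mem (hM _ _ hij) (hM _ _ hab)
  have : ofPerm (Equiv.swap i j) * e a b =
      e j b * (e i j * (e b i * e a b)) := by
    funext k
    simp only [mul_apply, e, ofPerm_apply, Equiv.swap_apply_def]
    grind
  rw [this]
  exact M.mul_mem (hM _ _ (Ne.symm hj)) (M.mul_mem (hM _ _ hij)
    (M.mul_mem (hM _ _ hi) (hM _ _ hab)))

/-- The transformations that map a subsemigroup into itself by left multiplication. -/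
def leftStabilizer {T : Type*} [Monoid T] (M : Subsemigroup T) : Submonoid T where
  carrier := {g | ∀ x ∈ M, g * x ∈ M}
  one_mem' := fun x hx => by rwa [one_mul]
  mul_mem' := fun {a b} ha hb x hx => by
    rw [mul_assoc]
    exact ha _ (hb _ hx)

theorem mem_leftStabilizer_closure {T : Type*} [Monoid T] {V : Set T} {g : T}
    (h : ∀ v ∈ V, g * v ∈ Subsemigroup.closure V) :
    g ∈ leftStabilizer (Subsemigroup.closure V) := by
  intro x hx
  induction hx using Subsemigroup.closure_induction with
  | mem x hx => exact h x hx
  | mul x y _ hy ihx _ =>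
    rw [← mul_assoc]
    exact Subsemigroup.mul_mem _ ihx hy

theorem perm_mem_leftStabilizer {m : ℕ} (f : Equiv.Perm (Fin m)) :
    ofPerm f ∈
      leftStabilizer (Subsemigroup.closure (elemIdem m)) := by
  induction f using Equiv.Perm.swap_induction_on with
  | one => exact Submonoid.one_mem _
  | swap_mul f x y hxy ih =>
    have h : ofPerm (Equiv.swap x y) ∈ leftStabilizer (Subsemigroup.closure (elemIdem m)) := by
      refine mem_leftStabilizer_closure ?_
      rintro _ ⟨a, b, hab, rfl⟩
      exact swap_mul_e_mem e_mem_closure_elemIdem hxy hab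
    have h' := Submonoid.mul_mem _ h ih
    exact h'

/-- A singular transformation factors through some `e a b`, with a left factor of larger image. -/
theorem exists_eq_mul_e {m : ℕ} {g : Function.End (Fin m)} (hg : g ∈ singular m) :
    ∃ a b, a ≠ b ∧ ∃ g' : Function.End (Fin m), g = g' * e a b ∧
      (Set.range (g : Fin m → Fin m)).ncard < (Set.range (g' : Fin m → Fin m)).ncard := by
  have hinj : ¬ Injective (g : Fin m → Fin m) := fun h => hg (Finite.injective_iff_bijective.1 h)
  have hsurj : ¬ Surjective (g : Fin m → Fin m) := fun h => hg (Finite.surjective_iff_bijective.1 h)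
  simp only [Injective, not_forall] at hinj
  obtain ⟨a, b, hab, hne⟩ := hinj
  simp only [Surjective, not_forall] at hsurj
  obtain ⟨c, hc⟩ := hsurj
  -- The left factor is `g` with its redundant value at `b` replaced by the missed point `c`, so its
  -- image gains `c` and loses nothing.
  have hup : ∀ k, k ≠ b → update (g : Fin m → Fin m) b c k = g k :=
    fun k hk => update_of_ne hk c g
  refine ⟨a, b, hne, update (g : Fin m → Fin m) b c, ?_, ?_⟩
  · funext k
    change g k = update (g : Fin m → Fin m) b c (e a b k)
    by_cases hk : k = b
    · subst hk
      rw [e_apply_self, hup a hne, hab]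
    · rw [e_apply_of_ne hk, hup k hk]
  · refine Set.ncard_lt_ncard ?_ (Set.toFinite _)
    refine (Set.ssubset_iff_of_subset ?_).2 ⟨c, ⟨b, update_self b c g⟩, ?_⟩
    · rintro _ ⟨k, rfl⟩
      by_cases hk : k = b
      · subst hk
        exact ⟨a, (hup a hne).trans hab⟩
      · exact ⟨k, hup k hk⟩
    · rintro ⟨k, hk⟩
      exact hc ⟨k, hk⟩

/-- Induction on the corank: peel off factors `e a b` until a permutation remains. -/
theorem mem_leftStabilizer_elemIdem {m : ℕ} (g : Function.End (Fin m)) :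
    g ∈ leftStabilizer (Subsemigroup.closure (elemIdem m)) := by
  by_cases hg : g ∈ singular m
  · obtain ⟨a, b, hab, g', rfl, hlt⟩ := exists_eq_mul_e hg
    refine Submonoid.mul_mem _ (mem_leftStabilizer_elemIdem g') ?_
    exact fun x hx => Subsemigroup.mul_mem _ (e_mem_closure_elemIdem a b hab) hx
  · have hb : Bijective (g : Fin m → Fin m) := not_not.1 hg
    exact perm_mem_leftStabilizer (Equiv.ofBijective _ hb)
termination_by m - (Set.range (g : Fin m → Fin m)).ncard
decreasing_by
  have : (Set.range (g' : Fin m → Fin m)).ncard ≤ m := by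
    simpa using Set.ncard_le_ncard (Set.subset_univ (Set.range (g' : Fin m → Fin m)))
  omega

theorem mul_mem_singular_left {m : ℕ} {f g : Function.End (Fin m)} (hf : f ∈ singular m) :
    f * g ∈ singular m := by
  intro hb
  exact hf (Finite.surjective_iff_bijective.1 (Surjective.of_comp hb.2))

theorem mul_mem_singular_right {m : ℕ} {f g : Function.End (Fin m)} (hg : g ∈ singular m) :
    f * g ∈ singular m := by
  intro hb
  exact hg (Finite.injective_iff_bijective.1 (Injective.of_comp hb.1))

/-- Howie's theorem: the idempotents `e i j` generate the semigroup of singular maps. -/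
theorem closure_elemIdem (m : ℕ) :
    (Subsemigroup.closure (elemIdem m) : Set (Function.End (Fin m))) = singular m := by
  apply Set.Subset.antisymm
  · intro x hx
    induction hx using Subsemigroup.closure_induction with
    | mem x hx =>
      obtain ⟨i, j, hij, rfl⟩ := hx
      exact e_mem_singular hij
    | mul x y _ _ ihx _ => exact mul_mem_singular_left ihx
  · intro g hg
    obtain ⟨a, b, hab, g', rfl, -⟩ := exists_eq_mul_e hg
    exact mem_leftStabilizer_elemIdem g' _ (e_mem_closure_elemIdem a b hab)

theorem closure_le_submonoid {T : Type*} [Monoid T] {V : Set T} {M : Submonoid T}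
    (h : V ⊆ M) : (Subsemigroup.closure V : Set T) ⊆ M :=
  (Subsemigroup.closure_le (S := M.toSubsemigroup)).2 h

theorem singular_subset_of_e_mem {m : ℕ} {M : Submonoid (Function.End (Fin m))}
    (h : ∀ i j, i ≠ j → e i j ∈ M) : singular m ⊆ M := by
  rw [← closure_elemIdem]
  refine closure_le_submonoid ?_
  rintro _ ⟨i, j, hij, rfl⟩
  exact h i j hij

theorem elemIdem_subset_idemCorankOne (m : ℕ) : elemIdem m ⊆ idemCorankOne m := by
  rintro _ ⟨i, j, hij, rfl⟩
  refine ⟨e_idem hij, ?_⟩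
  have : Set.range (e i j : Fin m → Fin m) = {j}ᶜ := by
    ext k
    constructor
    · rintro ⟨l, rfl⟩
      by_cases hl : l = j
      · subst hl
        simpa [e_apply_self] using hij
      · simpa [e_apply_of_ne hl] using hl
    · intro hk
      exact ⟨k, e_apply_of_ne hk⟩
  rw [this, Set.ncard_compl, Set.ncard_singleton, Nat.card_eq_fintype_card, Fintype.card_fin]
  have := j.pos
  omega

theorem idemCorankOne_subset_elemIdem (m : ℕ) : idemCorankOne m ⊆ elemIdem m := by
  rintro v ⟨hv, hr⟩
  have hne : Set.range (v : Fin m → Fin m) ≠ Set.univ := by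
    intro h
    rw [h, Set.ncard_univ, Nat.card_eq_fintype_card, Fintype.card_fin] at hr
    omega
  obtain ⟨j, hj⟩ := (Set.ne_univ_iff_exists_notMem _).1 hne
  have hsub : Set.range (v : Fin m → Fin m) ⊆ {j}ᶜ := by
    intro k hk hkj
    rw [Set.mem_singleton_iff] at hkj
    exact hj (hkj ▸ hk)
  have heq : Set.range (v : Fin m → Fin m) = {j}ᶜ := by
    refine Set.eq_of_subset_of_ncard_le hsub ?_ (Set.toFinite _)
    rw [Set.ncard_compl, Set.ncard_singleton, Nat.card_eq_fintype_card, Fintype.card_fin]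
    omega
  refine ⟨v j, j, fun h => hj ⟨j, h⟩, ?_⟩
  funext k
  by_cases hk : k = j
  · subst hk
    rw [e_apply_self]
  · rw [e_apply_of_ne hk]
    have : k ∈ Set.range (v : Fin m → Fin m) := by
      rw [heq]
      exact hk
    obtain ⟨l, rfl⟩ := this
    exact congrFun hv l

/-! ### A small idempotent generating set of `idemGen (Fin n)` -/

/-- The product around the triangle merges `i` and `j` and exchanges `j` and `k` on its image;
squaring removes the exchange. -/
theorem e_symm_mem_of_cycle {m : ℕ} {M : Submonoid (Function.End (Fin m))} {i j k : Fin m}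
    (hij : i ≠ j) (hjk : j ≠ k) (hki : k ≠ i) (h₁ : e i j ∈ M) (h₂ : e j k ∈ M)
    (h₃ : e k i ∈ M) : e j i ∈ M := by
  have : e j i = (e k i * (e j k * e i j)) * (e k i * (e j k * e i j)) := by
    funext l
    simp only [mul_apply, e]
    grind
  rw [this]
  exact M.mul_mem (M.mul_mem h₃ (M.mul_mem h₂ h₁)) (M.mul_mem h₃ (M.mul_mem h₂ h₁))

/-- The pairs `i < j` in `Fin n`. -/
abbrev OrdPair (n : ℕ) := {p : Fin n × Fin n // p.1 < p.2}

theorem card_ordPair (n : ℕ) : Fintype.card (OrdPair n) = n.choose 2 := by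
  have : OrdPair n ≃ Σ j : Fin n, Fin j :=
    { toFun := fun p => ⟨p.1.2, ⟨p.1.1, p.2⟩⟩
      invFun := fun s => ⟨(⟨s.2, s.2.2.trans s.1.2⟩, s.1), s.2.2⟩
      left_inv := fun _ => rfl
      right_inv := fun _ => rfl }
  rw [Fintype.card_congr this, Fintype.card_sigma]
  simp only [Fintype.card_fin]
  rw [Fin.sum_univ_eq_sum_range (fun i => i), Finset.sum_range_id, Nat.choose_two_right]

/-- The arcs of the transitive tournament on `Fin n` with the longest arc reversed. -/
def tournament (n : ℕ) (p : OrdPair n) : Function.End (Fin n) :=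
  if p.1.1.val = 0 ∧ p.1.2.val + 1 = n then e p.1.2 p.1.1 else e p.1.1 p.1.2

theorem singular_subset_closure_tournament {n : ℕ} (hn : 3 ≤ n) :
    singular n ⊆ Submonoid.closure (Set.range (tournament n)) := by
  set M := Submonoid.closure (Set.range (tournament n)) with hM
  have hlt : ∀ i j : Fin n, i < j → ¬ (i.val = 0 ∧ j.val + 1 = n) → e i j ∈ M := by
    intro i j hij h
    refine Submonoid.subset_closure ⟨⟨(i, j), hij⟩, ?_⟩
    simp [tournament, h]
  let o : Fin n := ⟨0, by omega⟩
  let t : Fin n := ⟨n - 1, by omega⟩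
  have hot : o < t := by simp only [o, t, Fin.lt_def]; omega
  have hto : e t o ∈ M := by
    refine Submonoid.subset_closure ⟨⟨(o, t), hot⟩, ?_⟩
    have : n - 1 + 1 = n := by omega
    simp [tournament, o, t, this]
  have h1 : ∀ k : Fin n, o < k → k < t → e o k ∈ M ∧ e k t ∈ M := by
    intro k hk hk'
    simp only [o, t, Fin.lt_def] at hk hk'
    exact ⟨hlt _ _ (by simpa [o, Fin.lt_def] using hk) (by omega),
      hlt _ _ (by simpa [t, Fin.lt_def] using hk') (by omega)⟩
  -- The reversed arc makes `o`, `k`, `t` a directed triangle for every inner `k`, so all three of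
  -- its arcs can be reversed.
  have h2 : ∀ k : Fin n, o < k → k < t → e k o ∈ M ∧ e t k ∈ M ∧ e o t ∈ M := by
    intro k hk hk'
    obtain ⟨ha, hb⟩ := h1 k hk hk'
    exact ⟨e_symm_mem_of_cycle hk.ne hk'.ne hot.ne' ha hb hto,
      e_symm_mem_of_cycle hk'.ne hot.ne' hk.ne hb hto ha,
      e_symm_mem_of_cycle hot.ne' hk.ne hk'.ne hto ha hb⟩
  have hgt : ∀ i j : Fin n, i < j → e i j ∈ M ∧ e j i ∈ M := by
    intro i j hij
    by_cases hi : i = o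
    · subst hi
      by_cases hj : j = t
      · subst hj
        refine ⟨?_, hto⟩
        refine (h2 ⟨1, by omega⟩ ?_ ?_).2.2 <;> simp only [o, t, Fin.lt_def] <;> omega
      · have hj' : j < t := by
          simp only [t, Fin.lt_def, Fin.ext_iff] at hj ⊢
          omega
        exact ⟨(h1 j hij hj').1, (h2 j hij hj').1⟩
    · have hi' : o < i := by
        simp only [o, Fin.lt_def, Fin.ext_iff] at hi ⊢
        omega
      by_cases hj : j = t
      · subst hj
        exact ⟨(h1 i hi' hij).2, (h2 i hi' hij).2.1⟩
      · have hj' : j < t := by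
          simp only [t, Fin.lt_def, Fin.ext_iff] at hj ⊢
          omega
        have hij' : e i j ∈ M := hlt i j hij (by
          simp only [o, Fin.lt_def] at hi'
          omega)
        -- For inner `i < j`, the arc `e j o` just obtained closes the triangle `i`, `j`, `o`.
        exact ⟨hij', e_symm_mem_of_cycle hij.ne (hi'.trans hij).ne' hi'.ne hij'
          (h2 j (hi'.trans hij) hj').1 (h1 i hi' (hij.trans hj')).1⟩
  refine singular_subset_of_e_mem ?_
  intro i j hij
  rcases lt_or_gt_of_ne hij with h | h
  · exact (hgt i j h).1
  · exact (hgt j i h).2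

theorem eq_one_of_idem_of_bijective {α : Type*} {f : Function.End α} (hf : IsIdempotentElem f)
    (hb : Injective (f : α → α)) : f = 1 := by
  funext x
  exact hb (congrFun hf x)

theorem isIdemGenSet_idemGen {n : ℕ} {V : Set (Function.End (Fin n))} (hV : V ⊆ elemIdem n)
    (h : singular n ⊆ Submonoid.closure V) : IsIdemGenSet (idemGen (Fin n)) V := by
  have hidem : ∀ v ∈ V, IsIdempotentElem v := by
    intro v hv
    obtain ⟨i, j, hij, rfl⟩ := hV hv
    exact e_idem hij
  refine ⟨hidem, le_antisymm (Submonoid.closure_mono hidem) (Submonoid.closure_le.2 ?_)⟩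
  intro f hf
  by_cases hb : f ∈ singular n
  · exact h hb
  · rw [eq_one_of_idem_of_bijective hf (not_not.1 hb).1]
    exact Submonoid.one_mem _

theorem singular_subset_idemGen (n : ℕ) : singular n ⊆ idemGen (Fin n) :=
  singular_subset_of_e_mem fun _ _ hij => Submonoid.subset_closure (e_idem hij)

theorem encard_range_le {ι α : Type*} [Fintype ι] (f : ι → α) :
    (Set.range f).encard ≤ (Fintype.card ι : ℕ∞) := by
  rw [← Set.image_univ]
  refine (Set.encard_image_le _ _).trans ?_
  rw [Set.encard_univ, ENat.card_eq_coe_fintype_card]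

theorem exists_isIdemGenSet_encard_le {n : ℕ} (hn : 2 ≤ n) :
    ∃ V, IsIdemGenSet (idemGen (Fin n)) V ∧ V.encard ≤ (rho n : ℕ∞) := by
  by_cases h2 : n = 2
  · subst h2
    refine ⟨Set.range fun i : Fin 2 => e i (1 - i), isIdemGenSet_idemGen ?_ ?_, ?_⟩
    · rintro _ ⟨i, rfl⟩
      exact ⟨i, 1 - i, by fin_cases i <;> decide, rfl⟩
    · refine singular_subset_of_e_mem fun i j hij => Submonoid.subset_closure ⟨i, ?_⟩
      have : 1 - i = j := by
        revert hij
        fin_cases i <;> fin_cases j <;> decide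
      rw [← this]
    · simpa [rho] using encard_range_le fun i : Fin 2 => e i (1 - i)
  · refine ⟨Set.range (tournament n), isIdemGenSet_idemGen ?_
      (singular_subset_closure_tournament (by omega)), ?_⟩
    · rintro _ ⟨p, rfl⟩
      unfold tournament
      split_ifs
      · exact ⟨_, _, p.2.ne', rfl⟩
      · exact ⟨_, _, p.2.ne, rfl⟩
    · rw [rho, if_neg h2, ← card_ordPair]
      exact encard_range_le _

theorem encard_le_rho_of_isMinIdemGenSet {n : ℕ} (hn : 2 ≤ n) {U : Set (Function.End (Fin n))}
    (hU : IsMinIdemGenSet (idemGen (Fin n)) U) : U.encard ≤ (rho n : ℕ∞) := by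
  obtain ⟨V, hV, hc⟩ := exists_isIdemGenSet_encard_le hn
  exact (hU.2 V hV).trans hc

theorem exists_isMinIdemGenSet {n : ℕ} (hn : 2 ≤ n) :
    ∃ U, IsMinIdemGenSet (idemGen (Fin n)) U := by
  obtain ⟨V, hV, -⟩ := exists_isIdemGenSet_encard_le hn
  obtain ⟨U, hU, hmin⟩ := exists_minimalFor_of_wellFoundedLT
    (IsIdemGenSet (idemGen (Fin n))) Set.encard ⟨V, hV⟩
  refine ⟨U, hU, fun U' hU' => ?_⟩
  rcases le_total U.encard U'.encard with h | h
  · exact h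
  · exact hmin hU' h

/-! ### The transformations `wr g h` -/

theorem ofPerm_mul {α : Type*} (f g : Equiv.Perm α) : ofPerm (f * g) = ofPerm f * ofPerm g := rfl

theorem ofPerm_one {α : Type*} : ofPerm (1 : Equiv.Perm α) = 1 := rfl

theorem ofPerm_mul_inv {α : Type*} (f : Equiv.Perm α) : ofPerm f * ofPerm f⁻¹ = 1 := by
  rw [← ofPerm_mul, mul_inv_cancel, ofPerm_one]

theorem exists_ofPerm_of_notMem_singular {n : ℕ} {g : Function.End (Fin n)}
    (hg : g ∉ singular n) : ∃ f, g = ofPerm f :=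
  ⟨Equiv.ofBijective _ (not_not.1 hg), rfl⟩

/-- The family with `g` in position `k` and the identity elsewhere. -/
def single {m n : ℕ} (k : Fin m) (g : Function.End (Fin n)) : Fin m → Function.End (Fin n) :=
  fun l => if l = k then g else 1

theorem single_self {m n : ℕ} (k : Fin m) (g : Function.End (Fin n)) : single k g k = g :=
  if_pos rfl

theorem single_of_ne {m n : ℕ} {k l : Fin m} (h : l ≠ k) (g : Function.End (Fin n)) :
    single k g l = 1 :=
  if_neg h

theorem single_one {m n : ℕ} (k : Fin m) : single k (1 : Function.End (Fin n)) = 1 := by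
  funext l
  exact ite_self _

theorem wr_mul {m n : ℕ} (g g' : Fin m → Function.End (Fin n)) (h h' : Function.End (Fin m)) :
    wr g h * wr g' h' = wr (fun k => g (h' k) * g' k) (h * h') := rfl

theorem wr_one {m n : ℕ} : wr (1 : Fin m → Function.End (Fin n)) 1 = 1 := rfl

theorem wr_inj {m n : ℕ} (hn : 0 < n) {g g' : Fin m → Function.End (Fin n)}
    {h h' : Function.End (Fin m)} (H : wr g h = wr g' h') : g = g' ∧ h = h' := by
  constructor
  · funext k x
    exact congrArg Prod.snd (congrFun H (k, x))
  · funext k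
    exact congrArg Prod.fst (congrFun H (k, (⟨0, hn⟩ : Fin n)))

theorem inBlock_eq {m n : ℕ} (i : Fin m) (g : Function.End (Fin n)) :
    inBlock i g = wr (single i g) 1 := rfl

theorem eBlock_eq {m n : ℕ} (i j : Fin m) (f : Equiv.Perm (Fin n)) :
    eBlock i j f = wr (single j (ofPerm f)) (e i j) := rfl

theorem eBlock_one {m n : ℕ} (i j : Fin m) :
    (eBlock i j 1 : Function.End (Fin m × Fin n)) = wr 1 (e i j) := by
  rw [eBlock_eq, ofPerm_one, single_one]

theorem inBlock_mul {m n : ℕ} (i : Fin m) (g g' : Function.End (Fin n)) :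
    inBlock i (g * g') = inBlock i g * inBlock i g' := by
  simp only [inBlock_eq, wr_mul, mul_one]
  congr 1
  funext k
  by_cases hk : k = i
  · subst hk
    simp [single_self, one_apply]
  · simp [single_of_ne hk, one_apply]

theorem inBlock_one {m n : ℕ} (i : Fin m) : inBlock i (1 : Function.End (Fin n)) = 1 := by
  rw [inBlock_eq, single_one, wr_one]

/-- The embedding `g ↦ g^{(i)}` as a homomorphism. -/
def inBlockHom {m : ℕ} (n : ℕ) (i : Fin m) :
    Function.End (Fin n) →* Function.End (Fin m × Fin n) where
  toFun := inBlock i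
  map_one' := inBlock_one i
  map_mul' := inBlock_mul i

/-- The embedding `h ↦ [1, …, 1; h]` as a homomorphism. -/
def permuteHom (m n : ℕ) : Function.End (Fin m) →* Function.End (Fin m × Fin n) where
  toFun := wr 1
  map_one' := rfl
  map_mul' := fun _ _ => rfl

theorem eBlock_idem {m n : ℕ} {i j : Fin m} (hij : i ≠ j) (f : Equiv.Perm (Fin n)) :
    IsIdempotentElem (eBlock i j f) := by
  rw [IsIdempotentElem, eBlock_eq, wr_mul, e_idem hij]
  congr 1
  funext k
  by_cases hk : k = j
  · subst hk
    simp [single_self, single_of_ne hij, e_apply_self]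
  · simp [single_of_ne hk, e_apply_of_ne hk]

/-! ### Generating all `eBlock i j f` -/

/-- The transformation `[…, q, …, q f, …; e i j]`, with `q` in position `i` and `q f` in `j`. -/
def rotBlock {m n : ℕ} (i j : Fin m) (f q : Equiv.Perm (Fin n)) : Function.End (Fin m × Fin n) :=
  wr (fun k => if k = i then ofPerm q else if k = j then ofPerm (q * f) else 1) (e i j)

theorem rotBlock_one {m n : ℕ} {i j : Fin m} (hij : i ≠ j) (f : Equiv.Perm (Fin n)) :
    rotBlock i j f 1 = eBlock i j f := by
  rw [rotBlock, eBlock_eq]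
  congr 1
  funext k
  by_cases hi : k = i
  · subst hi
    simp [single_of_ne hij, ofPerm_one]
  · by_cases hj : k = j
    · subst hj
      simp [single_self, hi]
    · simp [hi, hj, single_of_ne hj]

theorem rotBlock_mul {m n : ℕ} {i j : Fin m} (hij : i ≠ j) (f q q' : Equiv.Perm (Fin n)) :
    rotBlock i j f q * rotBlock i j f q' = rotBlock i j f (q * q') := by
  rw [rotBlock, rotBlock, wr_mul, e_idem hij, rotBlock]
  congr 1
  funext k
  by_cases hi : k = i
  · subst hi
    simp [e_apply_of_ne hij, ofPerm_mul]
  · by_cases hj : k = j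
    · subst hj
      simp [hi, e_apply_self, ofPerm_mul, mul_assoc]
    · simp [hi, hj, e_apply_of_ne hj]

/-- Only positive exponents are possible: the zeroth power is 1, not `rotBlock i j f 1`. -/
theorem rotBlock_pow {m n : ℕ} {i j : Fin m} (hij : i ≠ j) (f q : Equiv.Perm (Fin n)) (t : ℕ) :
    rotBlock i j f q ^ (t + 1) = rotBlock i j f (q ^ (t + 1)) := by
  induction t with
  | zero => rw [zero_add, pow_one, pow_one]
  | succ t ih => rw [pow_succ, ih, rotBlock_mul hij, ← pow_succ]

theorem eBlock_mul_eBlock_symm {m n : ℕ} {i j : Fin m} (hij : i ≠ j) (a f : Equiv.Perm (Fin n)) :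
    eBlock i j a * eBlock j i f⁻¹ = rotBlock i j f (a * f⁻¹) := by
  rw [eBlock_eq, eBlock_eq, wr_mul, rotBlock]
  have : e i j * e j i = e i j := by
    funext k
    simp only [mul_apply, e]
    grind
  rw [this]
  congr 1
  funext k
  by_cases hi : k = i
  · subst hi
    simp [e_apply_self, single_self, ofPerm_mul]
  · by_cases hj : k = j
    · subst hj
      simp [hi, e_apply_of_ne hij.symm, single_self, single_of_ne hij.symm]
    · simp [hi, hj, e_apply_of_ne hi, single_of_ne hi, single_of_ne hj]

/-- For `f ∈ B` and any `a ∈ A`, the product of the two available maps is `rotBlock i j f (a *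
f⁻¹)`; raising it to the order of `a * f⁻¹` removes the rotation and keeps `f`. -/
theorem eBlock_mem_of_cover {m n : ℕ} {M : Submonoid (Function.End (Fin m × Fin n))} {i j : Fin m}
    (hij : i ≠ j) {A B : Set (Equiv.Perm (Fin n))} (hA : ∀ f ∈ A, eBlock i j f ∈ M)
    (hB : ∀ f ∈ B, eBlock j i f⁻¹ ∈ M) (hne : A.Nonempty) (hAB : A ∪ B = Set.univ)
    (f : Equiv.Perm (Fin n)) : eBlock i j f ∈ M := by
  rcases (hAB ▸ Set.mem_univ f : f ∈ A ∪ B) with hf | hf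
  · exact hA f hf
  obtain ⟨a, ha⟩ := hne
  obtain ⟨t, ht⟩ : ∃ t, orderOf (a * f⁻¹) = t + 1 :=
    Nat.exists_eq_succ_of_ne_zero (orderOf_pos _).ne'
  have : rotBlock i j f (a * f⁻¹) ^ (t + 1) = eBlock i j f := by
    rw [rotBlock_pow hij, ← ht, pow_orderOf_eq_one, rotBlock_one hij]
  rw [← this, ← eBlock_mul_eBlock_symm hij]
  exact M.pow_mem (M.mul_mem (hA a ha) (hB f hf)) _

theorem exists_eq_mul_mem_right {T : Type*} [Monoid T] {G : Set T} {x : T}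
    (hx : x ∈ Submonoid.closure G) (hx1 : x ≠ 1) :
    ∃ y ∈ Submonoid.closure G, ∃ s ∈ G, s ≠ 1 ∧ x = y * s := by
  induction hx using Submonoid.closure_induction with
  | mem x hx => exact ⟨1, Submonoid.one_mem _, x, hx, hx1, (one_mul x).symm⟩
  | one => exact absurd rfl hx1
  | mul x y hx _ ihx ihy =>
    by_cases hy : y = 1
    · subst hy
      rw [mul_one] at hx1 ⊢
      exact ihx hx1
    · obtain ⟨z, hz, s, hs, hs1, rfl⟩ := ihy hy
      exact ⟨x * z, Submonoid.mul_mem _ hx hz, s, hs, hs1, (mul_assoc _ _ _).symm⟩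

theorem exists_eq_mul_mem_left {T : Type*} [Monoid T] {G : Set T} {x : T}
    (hx : x ∈ Submonoid.closure G) (hx1 : x ≠ 1) :
    ∃ s ∈ G, s ≠ 1 ∧ ∃ y ∈ Submonoid.closure G, x = s * y := by
  induction hx using Submonoid.closure_induction with
  | mem x hx => exact ⟨x, hx, hx1, 1, Submonoid.one_mem _, (mul_one x).symm⟩
  | one => exact absurd rfl hx1
  | mul x y _ hy ihx ihy =>
    by_cases hx' : x = 1
    · subst hx'
      rw [one_mul] at hx1 ⊢
      exact ihy hx1
    · obtain ⟨s, hs, hs1, z, hz, rfl⟩ := ihx hx'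
      exact ⟨s, hs, hs1, z * y, Submonoid.mul_mem _ hz hy, mul_assoc _ _ _⟩

theorem e_apply_eq_iff {m : ℕ} {i j a b : Fin m} (hab : a ≠ b) (h : e i j a = e i j b) :
    a = i ∧ b = j ∨ a = j ∧ b = i := by
  simp only [e] at h
  grind

/-- The last factor of `e i j` over `V` is some `e a b`, whose kernel pair must be `{i, j}`. -/
theorem e_mem_or_e_mem {m : ℕ} {V : Set (Function.End (Fin m))} (hV : V ⊆ idemCorankOne m)
    (hgen : (Subsemigroup.closure V : Set (Function.End (Fin m))) = singular m) {i j : Fin m}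
    (hij : i ≠ j) : e i j ∈ V ∨ e j i ∈ V := by
  have hmem : e i j ∈ Submonoid.closure V :=
    closure_le_submonoid Submonoid.subset_closure (hgen ▸ e_mem_singular hij)
  have hne : e i j ≠ 1 := fun h => e_mem_singular hij (h ▸ bijective_id)
  obtain ⟨y, -, s, hs, -, hys⟩ := exists_eq_mul_mem_right hmem hne
  obtain ⟨a, b, hab, rfl⟩ := idemCorankOne_subset_elemIdem m (hV hs)
  have : e i j a = e i j b := by
    rw [hys, mul_apply, mul_apply, e_apply_self, e_apply_of_ne hab]
  rcases e_apply_eq_iff hab this with ⟨rfl, rfl⟩ | ⟨rfl, rfl⟩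
  · exact Or.inl hs
  · exact Or.inr hs

/-- Block `i` meets both twists, which cancel; block `j` escapes the first one applied, `f⁻¹`, and
meets only `f`. -/
theorem eBlock_eq_mul {m n : ℕ} {i j : Fin m} (hij : i ≠ j) (f : Equiv.Perm (Fin n)) :
    eBlock i j f = (eBlock i j 1 * eBlock j i f) * (eBlock i j 1 * eBlock j i f⁻¹) := by
  simp only [eBlock_one]
  simp only [eBlock_eq, wr_mul]
  have : e i j * e j i * (e i j * e j i) = e i j := by
    funext k
    simp only [mul_apply, e]
    grind
  rw [this]
  congr 1
  funext k
  by_cases hi : k = i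
  · subst hi
    simp [e_apply_self, mul_apply, single_self, single_of_ne hij, ofPerm_mul_inv]
  · by_cases hj : k = j
    · subst hj
      simp [e_apply_of_ne hij.symm, e_apply_self, mul_apply, single_self, single_of_ne hij.symm]
    · simp [e_apply_of_ne hi, e_apply_of_ne hj, mul_apply, single_of_ne hi, single_of_ne hj]

/-- The set `setW V A B` generates all `eBlock i j f`. -/
theorem eBlock_mem_of_setW_subset {m n : ℕ} {V : Set (Function.End (Fin m))}
    {A B : Fin m → Fin m → Set (Equiv.Perm (Fin n))} (hV : V ⊆ idemCorankOne m)
    (hgen : (Subsemigroup.closure V : Set (Function.End (Fin m))) = singular m)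
    (hAB : ∀ i j, (i, j) ∈ Xi V → (A i j).Nonempty ∧ (B i j).Nonempty ∧
      Disjoint (A i j) (B i j) ∧ A i j ∪ B i j = Set.univ)
    {M : Submonoid (Function.End (Fin m × Fin n))} (hM : setW V A B ⊆ M) {i j : Fin m}
    (hij : i ≠ j) (f : Equiv.Perm (Fin n)) : eBlock i j f ∈ M := by
  have hXi : ∀ i j, (i, j) ∈ Xi V → ∀ f, eBlock i j f ∈ M ∧ eBlock j i f ∈ M := by
    intro i j h f
    obtain ⟨hA, hB, -, hU⟩ := hAB i j h
    have hAM : ∀ f ∈ A i j, eBlock i j f ∈ M := fun f hf =>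
      hM (Or.inr (Set.mem_biUnion h (Or.inl ⟨f, hf, rfl⟩)))
    have hBM : ∀ f ∈ B i j, eBlock j i f⁻¹ ∈ M := fun f hf =>
      hM (Or.inr (Set.mem_biUnion h (Or.inr ⟨f, hf, rfl⟩)))
    refine ⟨eBlock_mem_of_cover h.1.ne hAM hBM hA hU f, ?_⟩
    -- The opposite orientation is the same argument with the two sets inverted and exchanged.
    refine eBlock_mem_of_cover (A := (B i j)⁻¹) (B := (A i j)⁻¹) h.1.ne' ?_ ?_ hB.inv ?_ f
    · intro f hf
      simpa using hBM _ hf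
    · exact fun f hf => hAM _ hf
    · rw [← Set.union_inv, Set.union_comm, hU, Set.inv_univ]
  have hmemV : ∀ i j, i ≠ j → e i j ∈ V → ∀ f, eBlock i j f ∈ M := by
    intro i j hij h f
    by_cases h' : e j i ∈ V
    · rcases lt_or_gt_of_ne hij with hlt | hlt
      · exact (hXi i j ⟨hlt, h, h'⟩ f).1
      · exact (hXi j i ⟨hlt, h', h⟩ f).2
    · have hp : (i, j) ∈ Phi V := ⟨hij, h, h'⟩
      exact hM (Or.inl (Set.mem_biUnion hp ⟨f, rfl⟩))
  have hone : eBlock i j 1 ∈ M := by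
    have hVM : V ⊆ M.comap (permuteHom m n) := by
      intro v hv
      obtain ⟨a, b, hab, rfl⟩ := idemCorankOne_subset_elemIdem m (hV hv)
      have := hmemV a b hab hv 1
      rwa [eBlock_one] at this
    have := closure_le_submonoid hVM (hgen ▸ e_mem_singular hij)
    rw [eBlock_one]
    exact this
  rcases e_mem_or_e_mem hV hgen hij with h | h
  · exact hmemV i j hij h f
  · rw [eBlock_eq_mul hij]
    exact M.mul_mem (M.mul_mem hone (hmemV j i hij.symm h f))
      (M.mul_mem hone (hmemV j i hij.symm h f⁻¹))

/-! ### Generating the whole monoid -/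

section Generation

variable {m n : ℕ} {M : Submonoid (Function.End (Fin m × Fin n))}

theorem wr_one_mem (hE : ∀ i j, i ≠ j → ∀ f, eBlock i j f ∈ M) {h : Function.End (Fin m)}
    (hh : h ∈ singular m) : wr 1 h ∈ M := by
  refine singular_subset_of_e_mem (M := M.comap (permuteHom m n)) ?_ hh
  intro i j hij
  have := hE i j hij 1
  rwa [eBlock_one] at this

theorem wr_e_mul_inBlock (i j k : Fin m) (g : Function.End (Fin n)) :
    wr 1 (e i j) * inBlock k g = wr (single k g) (e i j) := by
  rw [inBlock_eq, wr_mul]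
  rfl

theorem wr_single_mem (hS : ∀ i, ∀ g ∈ idemGen (Fin n), inBlock i g ∈ M)
    (hE : ∀ i j, i ≠ j → ∀ f, eBlock i j f ∈ M) {i j : Fin m} (hij : i ≠ j) (k : Fin m)
    (g : Function.End (Fin n)) : wr (single k g) (e i j) ∈ M := by
  by_cases hg : g ∈ singular n
  · rw [← wr_e_mul_inBlock]
    exact M.mul_mem (wr_one_mem hE (e_mem_singular hij)) (hS k g (singular_subset_idemGen n hg))
  obtain ⟨f, rfl⟩ := exists_ofPerm_of_notMem_singular hg
  by_cases hj : k = j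
  · subst hj
    exact hE i k hij f
  by_cases hi : k = i
  · subst hi
    -- Block `k` travels to `j`, picking up `f`, and returns with block `j`.
    have : wr (single k (ofPerm f)) (e k j) = eBlock k j 1 * eBlock j k f := by
      rw [eBlock_one, eBlock_eq, wr_mul]
      congr 1
      funext l
      simp only [mul_apply, e]
      grind
    rw [this]
    exact M.mul_mem (hE _ _ hij 1) (hE _ _ hij.symm f)
  -- Once `e i j` has emptied block `j`, block `k` can go there and back, picking up `f`.
  · have : wr (single k (ofPerm f)) (e i j) = eBlock k j 1 * (eBlock j k f * eBlock i j 1) := by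
      rw [eBlock_one, eBlock_one, eBlock_eq, wr_mul, wr_mul]
      congr 1
      · funext l
        by_cases hl : l = j
        · subst hl
          simp [e_apply_self, single_of_ne (Ne.symm hj), single_of_ne (Ne.symm hi)]
        · simp [e_apply_of_ne hl]
      · funext l
        simp only [mul_apply, e]
        grind
    rw [this]
    exact M.mul_mem (hE _ _ hj 1) (M.mul_mem (hE _ _ (Ne.symm hj) f) (hE _ _ hij 1))

theorem wr_pair_mem (hS : ∀ i, ∀ g ∈ idemGen (Fin n), inBlock i g ∈ M)
    (hE : ∀ i j, i ≠ j → ∀ f, eBlock i j f ∈ M) {i j : Fin m} (hij : i ≠ j)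
    (a b : Function.End (Fin n)) :
    wr (fun k => if k = i then a else if k = j then b else 1) (e i j) ∈ M := by
  by_cases ha : a ∈ singular n
  · have : wr (fun k => if k = i then a else if k = j then b else 1) (e i j) =
        wr (single j b) (e i j) * inBlock i a := by
      rw [inBlock_eq, wr_mul]
      congr 1
      funext k
      by_cases hi : k = i
      · subst hi
        simp [single_self, single_of_ne hij, one_apply]
      · simp [hi, one_apply, single]
    rw [this]
    exact M.mul_mem (wr_single_mem hS hE hij j b) (hS i a (singular_subset_idemGen n ha))
  · obtain ⟨f, rfl⟩ := exists_ofPerm_of_notMem_singular ha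
    -- Block `j` lands in block `i` and then also meets `f`, so its component is corrected by `f⁻¹`
    -- beforehand.
    have : wr (fun k => if k = i then ofPerm f else if k = j then b else 1) (e i j) =
        wr (single i (ofPerm f)) (e i j) * wr (single j (ofPerm f⁻¹ * b)) (e i j) := by
      rw [wr_mul, e_idem hij]
      congr 1
      funext k
      by_cases hj : k = j
      · subst hj
        simp [single_self, e_apply_self, ← mul_assoc, ofPerm_mul_inv, hij.symm]
      · simp [hj, e_apply_of_ne hj, single]
    rw [this]
    exact M.mul_mem (wr_single_mem hS hE hij _ _) (wr_single_mem hS hE hij _ _)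

theorem wr_e_mem (hS : ∀ i, ∀ g ∈ idemGen (Fin n), inBlock i g ∈ M)
    (hE : ∀ i j, i ≠ j → ∀ f, eBlock i j f ∈ M) {i j : Fin m} (hij : i ≠ j)
    (g : Fin m → Function.End (Fin n)) : wr g (e i j) ∈ M := by
  have key : ∀ s : Finset (Fin m), i ∉ s → j ∉ s →
      wr (fun k => if k = i then g i else if k = j then g j else if k ∈ s then g k else 1)
        (e i j) ∈ M := by
    intro s
    induction s using Finset.induction_on with
    | empty =>
      intro _ _
      simpa using wr_pair_mem hS hE hij (g i) (g j)
    | insert k s hk ih =>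
      intro hi hj
      simp only [Finset.mem_insert, not_or] at hi hj
      have := M.mul_mem (wr_single_mem hS hE hij k (g k)) (ih hi.2 hj.2)
      rw [wr_mul, e_idem hij] at this
      convert this using 2
      funext l
      by_cases hli : l = i
      · subst hli
        simp [e_apply_of_ne hij, single_of_ne hi.1]
      by_cases hlj : l = j
      · subst hlj
        simp [hli, e_apply_self, single_of_ne hi.1]
      by_cases hlk : l = k
      · subst hlk
        simp [hli, hlj, hk, e_apply_of_ne hlj, single_self]
      · simp [hli, hlj, hlk, e_apply_of_ne hlj, single_of_ne hlk]
  convert key (Finset.univ \ {i, j}) (by simp) (by simp) using 2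
  funext k
  split_ifs with h1 h2 h3
  · rw [h1]
  · rw [h2]
  · rfl
  · simp [h1, h2] at h3

/-- Since `h` absorbs `e a b` on the right, all components can be applied together with `e a b`,
followed by the untwisted `h`. -/
theorem wr_mem_of_singular (hS : ∀ i, ∀ g ∈ idemGen (Fin n), inBlock i g ∈ M)
    (hE : ∀ i j, i ≠ j → ∀ f, eBlock i j f ∈ M) (g : Fin m → Function.End (Fin n))
    {h : Function.End (Fin m)} (hh : h ∈ singular m) : wr g h ∈ M := by
  obtain ⟨a, b, hab, h', rfl, -⟩ := exists_eq_mul_e hh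
  have : wr g (h' * e a b) = wr 1 (h' * e a b) * wr g (e a b) := by
    rw [wr_mul, mul_assoc, e_idem hab]
    rfl
  rw [this]
  exact M.mul_mem (wr_one_mem hE hh) (wr_e_mem hS hE hab g)

theorem wr_one_right_mem (hS : ∀ i, ∀ g ∈ idemGen (Fin n), inBlock i g ∈ M)
    {g : Fin m → Function.End (Fin n)} (hg : ∀ i, g i ∈ idemGen (Fin n)) : wr g 1 ∈ M := by
  have key : ∀ s : Finset (Fin m), wr (fun k => if k ∈ s then g k else 1) 1 ∈ M := by
    intro s
    induction s using Finset.induction_on with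
    | empty => exact M.one_mem
    | insert k s hk ih =>
      have := M.mul_mem (hS k (g k) (hg k)) ih
      rw [inBlock_eq, wr_mul, mul_one] at this
      convert this using 2
      funext l
      by_cases hlk : l = k
      · subst hlk
        simp [hk, one_apply, single_self]
      · simp [hlk, one_apply, single_of_ne hlk]
  simpa using key Finset.univ

theorem exists_wr_of_mem_preserving {f : Function.End (Fin m × Fin n)}
    (hf : f ∈ preserving (blocks m n)) : ∃ g h, f = wr g h := by
  have : ∀ i : Fin m, ∃ j, ∀ x, (f (i, x)).1 = j := by
    intro i
    obtain ⟨_, ⟨j, rfl⟩, hj⟩ := hf _ ⟨i, rfl⟩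
    exact ⟨j, fun x => hj (i, x) rfl⟩
  choose h hh using this
  refine ⟨fun i x => (f (i, x)).2, h, ?_⟩
  funext ⟨i, x⟩
  exact Prod.ext (hh i x) rfl

theorem wr_mem_preserving (g : Fin m → Function.End (Fin n)) (h : Function.End (Fin m)) :
    wr g h ∈ preserving (blocks m n) := by
  rintro _ ⟨i, rfl⟩
  exact ⟨_, ⟨h i, rfl⟩, fun x hx => congrArg h hx⟩

theorem isIdempotentElem_wr (hn : 0 < n) {g : Fin m → Function.End (Fin n)}
    {h : Function.End (Fin m)} (hw : IsIdempotentElem (wr g h)) :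
    h ∈ singular m ∨ h = 1 ∧ ∀ i, IsIdempotentElem (g i) := by
  obtain ⟨hg, hh⟩ := wr_inj hn ((wr_mul g g h h).symm.trans hw)
  by_cases hs : h ∈ singular m
  · exact Or.inl hs
  · have h1 := eq_one_of_idem_of_bijective hh (not_not.1 hs).1
    subst h1
    exact Or.inr ⟨rfl, fun i => congrFun hg i⟩

theorem idemGenPreserving_le (hn : 0 < n) (hS : ∀ i, ∀ g ∈ idemGen (Fin n), inBlock i g ∈ M)
    (hE : ∀ i j, i ≠ j → ∀ f, eBlock i j f ∈ M) : idemGenPreserving (blocks m n) ≤ M := by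
  refine Submonoid.closure_le.2 ?_
  rintro f ⟨hf, hi⟩
  obtain ⟨g, h, rfl⟩ := exists_wr_of_mem_preserving hf
  rcases isIdempotentElem_wr hn hi with hh | ⟨rfl, hg⟩
  · exact wr_mem_of_singular hS hE g hh
  · exact wr_one_right_mem hS fun i => Submonoid.subset_closure (hg i)

end Generation

/-! ### Lower bound for generating sets -/

section LowerBound

variable {m n : ℕ}

theorem one_notMem_singular (k : ℕ) : (1 : Function.End (Fin k)) ∉ singular k :=
  fun h => h bijective_id

theorem notMem_singular_of_mul_eq_one {k : ℕ} {f g : Function.End (Fin k)} (h : f * g = 1) :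
    f ∉ singular k ∧ g ∉ singular k :=
  ⟨fun hf => one_notMem_singular k (h ▸ mul_mem_singular_left hf),
    fun hg => one_notMem_singular k (h ▸ mul_mem_singular_right hg)⟩

/-- The only transformations `wr g h` in the idempotent-generated monoid with bijective `h` are
those with `h = 1` and each `g i` singular or trivial. -/
theorem exists_wr_of_mem (hn : 0 < n) {x : Function.End (Fin m × Fin n)}
    (hx : x ∈ idemGenPreserving (blocks m n)) :
    ∃ g h, x = wr g h ∧ (h ∈ singular m ∨ h = 1 ∧ ∀ i, g i ∈ singular n ∨ g i = 1) := by
  induction hx using Submonoid.closure_induction with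
  | mem x hx =>
    obtain ⟨g, h, rfl⟩ := exists_wr_of_mem_preserving hx.1
    refine ⟨g, h, rfl, (isIdempotentElem_wr hn hx.2).imp_right fun ⟨h1, hg⟩ => ⟨h1, fun i => ?_⟩⟩
    by_cases hi : g i ∈ singular n
    · exact Or.inl hi
    · exact Or.inr (eq_one_of_idem_of_bijective (hg i) (not_not.1 hi).1)
  | one => exact ⟨1, 1, rfl, Or.inr ⟨rfl, fun _ => Or.inr rfl⟩⟩
  | mul x y _ _ ihx ihy =>
    obtain ⟨g, h, rfl, H⟩ := ihx
    obtain ⟨g', h', rfl, H'⟩ := ihy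
    refine ⟨_, _, wr_mul g g' h h', ?_⟩
    rcases H with H | ⟨rfl, H⟩
    · exact Or.inl (mul_mem_singular_left H)
    rcases H' with H' | ⟨rfl, H'⟩
    · exact Or.inl (mul_mem_singular_right H')
    refine Or.inr ⟨one_mul 1, fun i => ?_⟩
    rcases H i with hi | hi
    · exact Or.inl (mul_mem_singular_left hi)
    rcases H' i with hi' | hi'
    · exact Or.inl (mul_mem_singular_right hi')
    · right
      rw [one_apply, hi, hi', one_mul]

/-- The base maps multiply to 1, as do the components outside block `i`; absence of nontrivial units
makes each of these factors 1. -/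
theorem exists_inBlock_of_mul_eq (hn : 0 < n) {x y : Function.End (Fin m × Fin n)}
    (hx : x ∈ idemGenPreserving (blocks m n)) (hy : y ∈ idemGenPreserving (blocks m n))
    {i : Fin m} {c : Function.End (Fin n)} (hxy : inBlock i c = x * y) :
    ∃ u u', x = inBlock i u ∧ y = inBlock i u' ∧ c = u * u' ∧ (u ∈ singular n ∨ u = 1) ∧
      (u' ∈ singular n ∨ u' = 1) := by
  obtain ⟨g, h, rfl, H⟩ := exists_wr_of_mem hn hx
  obtain ⟨g', h', rfl, H'⟩ := exists_wr_of_mem hn hy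
  obtain ⟨hg, hh⟩ := wr_inj hn ((inBlock_eq i c).symm.trans (hxy.trans (wr_mul g g' h h')))
  obtain ⟨hs, hs'⟩ := notMem_singular_of_mul_eq_one hh.symm
  obtain ⟨rfl, Hg⟩ := H.resolve_left hs
  obtain ⟨rfl, Hg'⟩ := H'.resolve_left hs'
  have hone : ∀ k, k ≠ i → g k = 1 ∧ g' k = 1 := by
    intro k hk
    have := congrFun hg k
    rw [single_of_ne hk] at this
    obtain ⟨h1, h2⟩ := notMem_singular_of_mul_eq_one this.symm
    exact ⟨(Hg k).resolve_left h1, (Hg' k).resolve_left h2⟩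
  refine ⟨g i, g' i, ?_, ?_, ?_, Hg i, Hg' i⟩
  · rw [inBlock_eq]
    congr 1
    funext k
    by_cases hk : k = i
    · subst hk
      rw [single_self]
    · rw [single_of_ne hk, (hone k hk).1]
  · rw [inBlock_eq]
    congr 1
    funext k
    by_cases hk : k = i
    · subst hk
      rw [single_self]
    · rw [single_of_ne hk, (hone k hk).2]
  · have := congrFun hg i
    rwa [single_self] at this

theorem inBlock_injective (hn : 0 < n) (i : Fin m) :
    Injective (inBlock i : Function.End (Fin n) → Function.End (Fin m × Fin n)) := by
  intro u v h
  have := congrFun (wr_inj hn h).1 i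
  simpa using this

theorem inBlock_mem (i : Fin m) {g : Function.End (Fin n)} (hg : g ∈ idemGen (Fin n)) :
    inBlock i g ∈ idemGenPreserving (blocks m n) := by
  have : idemGen (Fin n) ≤ (idemGenPreserving (blocks m n)).comap (inBlockHom n i) :=
    Submonoid.closure_le.2 fun f hf =>
      Submonoid.subset_closure ⟨wr_mem_preserving (single i f) 1,
        IsIdempotentElem.map hf (inBlockHom n i)⟩
  exact this hg

theorem eBlock_mem {i j : Fin m} (hij : i ≠ j) (f : Equiv.Perm (Fin n)) :
    eBlock i j f ∈ idemGenPreserving (blocks m n) :=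
  Submonoid.subset_closure ⟨wr_mem_preserving _ _, eBlock_idem hij f⟩

variable {G : Set (Function.End (Fin m × Fin n))}

theorem inBlock_e_ne_one (hn : 0 < n) (i : Fin m) {a b : Fin n} (hab : a ≠ b) :
    inBlock i (e a b) ≠ 1 := by
  intro h
  rw [← inBlock_one i] at h
  exact one_notMem_singular n (inBlock_injective hn i h ▸ e_mem_singular hab)

theorem IsGenSet.exists_inBlock_ker (hn : 0 < n) (hG : IsGenSet (idemGenPreserving (blocks m n)) G)
    (i : Fin m) {a b : Fin n} (hab : a ≠ b) :
    ∃ u ∈ singular n, inBlock i u ∈ G ∧ ∀ x y, u x = u y → e a b x = e a b y := by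
  have hG' : Submonoid.closure G = idemGenPreserving (blocks m n) := hG
  have hmem := inBlock_mem i (singular_subset_idemGen n (e_mem_singular hab))
  rw [← hG'] at hmem
  obtain ⟨y, hy, s, hs, hs1, heq⟩ := exists_eq_mul_mem_right hmem (inBlock_e_ne_one hn i hab)
  obtain ⟨u', u, -, rfl, hc, -, hu⟩ := exists_inBlock_of_mul_eq hn (hG' ▸ hy)
    (hG' ▸ Submonoid.subset_closure hs) heq
  refine ⟨u, hu.resolve_right ?_, hs, fun x y hxy => ?_⟩
  · rintro rfl
    exact hs1 (inBlock_one i)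
  · rw [hc, mul_apply, mul_apply, hxy]

theorem apply_eq_of_mem_singular_two {u : Function.End (Fin 2)} (hu : u ∈ singular 2) (x y : Fin 2) :
    u x = u y := by
  by_contra h
  refine hu (Finite.injective_iff_bijective.1 fun a b hab => ?_)
  by_contra hne
  fin_cases a <;> fin_cases b <;> fin_cases x <;> fin_cases y <;>
    first
    | exact hne rfl
    | exact h rfl
    | exact h hab
    | exact h hab.symm

/-- Kernels cannot tell the two constants apart, so the leftmost factor is used: it is constant and
equals the whole product. -/
theorem IsGenSet.inBlock_e_mem {G : Set (Function.End (Fin m × Fin 2))}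
    (hG : IsGenSet (idemGenPreserving (blocks m 2)) G) (i : Fin m) {a b : Fin 2} (hab : a ≠ b) :
    inBlock i (e a b) ∈ G := by
  have hG' : Submonoid.closure G = idemGenPreserving (blocks m 2) := hG
  have hmem := inBlock_mem i (singular_subset_idemGen 2 (e_mem_singular hab))
  rw [← hG'] at hmem
  obtain ⟨s, hs, hs1, y, hy, heq⟩ := exists_eq_mul_mem_left hmem (inBlock_e_ne_one two_pos i hab)
  obtain ⟨u, u', rfl, -, hc, hu, -⟩ := exists_inBlock_of_mul_eq two_pos
    (hG' ▸ Submonoid.subset_closure hs) (hG' ▸ hy) heq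
  have hu : u ∈ singular 2 := hu.resolve_right (by
    rintro rfl
    exact hs1 (inBlock_one i))
  have : e a b = u := by
    funext x
    rw [hc, mul_apply]
    exact apply_eq_of_mem_singular_two hu _ _
  rwa [this]

theorem IsGenSet.exists_injective_inBlock (hn : 2 ≤ n)
    (hG : IsGenSet (idemGenPreserving (blocks m n)) G) (i : Fin m) :
    ∃ φ : Fin (rho n) → Function.End (Fin n), Injective φ ∧
      ∀ d, φ d ∈ singular n ∧ inBlock i (φ d) ∈ G := by
  by_cases h2 : n = 2
  · subst h2
    have hne : ∀ d : Fin 2, d ≠ 1 - d := by decide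
    refine ⟨fun d : Fin 2 => e d (1 - d), fun d d' h => ?_, fun d =>
      ⟨e_mem_singular (hne d), hG.inBlock_e_mem i (hne d)⟩⟩
    have h0 : ∀ d x : Fin 2, e d (1 - d) x = d := by
      unfold e
      decide
    have := congrFun h 0
    exact (h0 d 0).symm.trans (this.trans (h0 d' 0))
  · have hcard : Fintype.card (Fin (rho n)) = Fintype.card (OrdPair n) := by
      rw [card_ordPair, Fintype.card_fin, rho, if_neg h2]
    let E := Fintype.equivOfCardEq hcard
    choose φ hφ using fun p : OrdPair n => hG.exists_inBlock_ker (by omega) i p.2.ne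
    refine ⟨fun d => φ (E d), ?_, fun d => ⟨(hφ (E d)).1, (hφ (E d)).2.1⟩⟩
    refine Injective.comp (g := φ) ?_ E.injective
    intro p q hpq
    have hinj : ¬ Injective (φ p : Fin n → Fin n) :=
      fun h => (hφ p).1 (Finite.injective_iff_bijective.1 h)
    simp only [Injective, not_forall] at hinj
    obtain ⟨x, y, hxy, hne⟩ := hinj
    -- A shared generator merges some `x ≠ y`, which forces both ordered pairs to be `{x, y}`.
    have h1 := e_apply_eq_iff hne ((hφ p).2.2 x y hxy)
    have h2 := e_apply_eq_iff hne ((hφ q).2.2 x y (hpq ▸ hxy))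
    have hp := p.2
    have hq := q.2
    apply Subtype.ext
    apply Prod.ext <;> grind

theorem eBlock_ker_same_block {i j : Fin m} {f : Equiv.Perm (Fin n)} {k : Fin m} {x y : Fin n}
    (h : eBlock i j f (k, x) = eBlock i j f (k, y)) : x = y := by
  have : single j (ofPerm f) k x = single j (ofPerm f) k y := congrArg Prod.snd h
  by_cases hk : k = j
  · subst hk
    rw [single_self] at this
    exact f.injective this
  · rwa [single_of_ne hk] at this

theorem IsGenSet.exists_eBlock_ker (hn : 0 < n) (hG : IsGenSet (idemGenPreserving (blocks m n)) G)
    {i j : Fin m} (hij : i ≠ j) (f : Equiv.Perm (Fin n)) :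
    ∃ g h, wr g h ∈ G ∧ h ∈ singular m ∧ (∀ a b, h a = h b → e i j a = e i j b) ∧ h i = h j ∧
      Injective (g i : Fin n → Fin n) ∧ ∀ x, g i (f x) = g j x := by
  have hG' : Submonoid.closure G = idemGenPreserving (blocks m n) := hG
  have hmem := eBlock_mem hij f
  rw [← hG'] at hmem
  have hne : eBlock i j f ≠ 1 := by
    intro h
    exact one_notMem_singular m ((wr_inj hn (h.trans wr_one.symm)).2 ▸ e_mem_singular hij)
  obtain ⟨y, -, s, hs, hs1, heq⟩ := exists_eq_mul_mem_right hmem hne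
  obtain ⟨g, h, rfl, H⟩ := exists_wr_of_mem hn (hG' ▸ Submonoid.subset_closure hs)
  have hker : ∀ p q, wr g h p = wr g h q → eBlock i j f p = eBlock i j f q := by
    intro p q hpq
    rw [heq, mul_apply, mul_apply, hpq]
  have hinj : ∀ k, Injective (g k : Fin n → Fin n) := fun k x y hxy =>
    eBlock_ker_same_block (hker (k, x) (k, y) (Prod.ext rfl hxy))
  have hsurj : ∀ k, Surjective (g k : Fin n → Fin n) := fun k =>
    Finite.surjective_of_injective (hinj k)
  -- Otherwise `h = 1` and the injective components are all 1, contradicting `s ≠ 1`.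
  have hsing : h ∈ singular m := by
    refine H.resolve_right ?_
    rintro ⟨rfl, Hg⟩
    refine hs1 (wr_one ▸ congrArg (wr · 1) (funext fun k => (Hg k).resolve_left fun hk => ?_))
    exact hk (Finite.injective_iff_bijective.1 (hinj k))
  have hcross : ∀ a b, h a = h b → ∀ x, ∃ z, g a z = g b x ∧ eBlock i j f (a, z) =
      eBlock i j f (b, x) := by
    intro a b hab x
    obtain ⟨z, hz⟩ := hsurj a (g b x)
    exact ⟨z, hz, hker (a, z) (b, x) (Prod.ext hab hz)⟩
  have hbase : ∀ a b, h a = h b → e i j a = e i j b := by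
    intro a b hab
    obtain ⟨z, -, hz⟩ := hcross a b hab ⟨0, hn⟩
    exact congrArg Prod.fst hz
  have hhij : h i = h j := by
    have hni : ¬ Injective (h : Fin m → Fin m) := fun hi =>
      hsing (Finite.injective_iff_bijective.1 hi)
    simp only [Injective, not_forall] at hni
    obtain ⟨a, b, hab, hne⟩ := hni
    rcases e_apply_eq_iff hne (hbase a b hab) with ⟨rfl, rfl⟩ | ⟨rfl, rfl⟩
    · exact hab
    · exact hab.symm
  refine ⟨g, h, hs, hsing, hbase, hhij, hinj i, fun x => ?_⟩
  obtain ⟨z, hz, hz'⟩ := hcross i j hhij x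
  have : single j (ofPerm f) i z = single j (ofPerm f) j x := congrArg Prod.snd hz'
  rw [single_of_ne hij, single_self, one_apply, ofPerm_apply] at this
  rw [← this, hz]

theorem IsGenSet.exists_injective_eBlock (hn : 0 < n)
    (hG : IsGenSet (idemGenPreserving (blocks m n)) G) :
    ∃ ψ : OrdPair m × Equiv.Perm (Fin n) → Function.End (Fin m × Fin n), Injective ψ ∧
      ∀ d, ψ d ∈ G ∧ ∃ g h, ψ d = wr g h ∧ h ∈ singular m := by
  choose g h hgh using fun d : OrdPair m × Equiv.Perm (Fin n) =>
    hG.exists_eBlock_ker hn d.1.2.ne d.2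
  refine ⟨fun d => wr (g d) (h d), ?_, fun d => ⟨(hgh d).1, _, _, rfl, (hgh d).2.1⟩⟩
  rintro ⟨⟨⟨i, j⟩, hij⟩, f⟩ ⟨⟨⟨i', j'⟩, hij'⟩, f'⟩ H
  obtain ⟨hgg, hhh⟩ := wr_inj hn H
  obtain ⟨-, -, -, hk, hinj, hf⟩ := hgh (⟨(i, j), hij⟩, f)
  obtain ⟨-, -, hb', -, -, hf'⟩ := hgh (⟨(i', j'), hij'⟩, f')
  rw [hhh] at hk
  have hpair := e_apply_eq_iff (ne_of_lt hij) (hb' _ _ hk)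
  simp only at hij hij' hpair
  obtain ⟨rfl, rfl⟩ : i = i' ∧ j = j' := by
    rcases hpair with h | ⟨rfl, rfl⟩
    · exact h
    · exact absurd hij hij'.asymm
  have : f = f' := by
    ext1 x
    apply hinj
    rw [hf x, hgg, hf' x]
  rw [this]

theorem IsGenSet.le_encard (hn : 2 ≤ n) (hG : IsGenSet (idemGenPreserving (blocks m n)) G) :
    ((m * rho n + n.factorial * m.choose 2 : ℕ) : ℕ∞) ≤ G.encard := by
  have hn0 : 0 < n := by omega
  choose φ hφ hφG using hG.exists_injective_inBlock hn
  obtain ⟨ψ, hψ, hψG⟩ := hG.exists_injective_eBlock hn0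
  let F : (Fin m × Fin (rho n)) ⊕ (OrdPair m × Equiv.Perm (Fin n)) →
    Function.End (Fin m × Fin n) := Sum.elim (fun p => inBlock p.1 (φ p.1 p.2)) ψ
  have hF : Injective F := by
    refine Injective.sumElim ?_ hψ ?_
    · rintro ⟨i, d⟩ ⟨i', d'⟩ h
      have hg := (wr_inj hn0 h).1
      have hi : i = i' := by
        by_contra hne
        have := congrFun hg i
        simp only [if_true, if_neg hne] at this
        exact one_notMem_singular n (this ▸ (hφG i d).1)
      subst hi
      exact congrArg (Prod.mk i) (hφ i (inBlock_injective hn0 i h))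
    · rintro ⟨i, d⟩ q h
      obtain ⟨-, g, k, hq, hk⟩ := hψG q
      exact one_notMem_singular m ((wr_inj hn0 (h.trans hq)).2 ▸ hk)
  have hFG : Set.range F ⊆ G := by
    rintro _ ⟨p | p, rfl⟩
    · exact (hφG p.1 p.2).2
    · exact (hψG p).1
  refine le_trans (le_of_eq ?_) (hF.encard_range.trans (Set.encard_le_encard hFG))
  rw [ENat.card_eq_coe_fintype_card]
  congr 1
  simp only [Fintype.card_sum, Fintype.card_prod, Fintype.card_fin, card_ordPair,
    Fintype.card_perm]
  ring

end LowerBound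

/-! ### The generating set -/

theorem setW_encard_le {m n : ℕ} {V : Set (Function.End (Fin m))}
    {A B : Fin m → Fin m → Set (Equiv.Perm (Fin n))}
    (hAB : ∀ i j, (i, j) ∈ Xi V → Disjoint (A i j) (B i j)) :
    (setW V A B).encard ≤ ((n.factorial * m.choose 2 : ℕ) : ℕ∞) := by
  classical
  -- `eBlock i j f` and `eBlock j i f⁻¹` have the same kernel, and `W` takes one of them: as `V`
  -- dictates if it has a single arc, by membership in `A` if it has both.
  let w : OrdPair m × Equiv.Perm (Fin n) → Function.End (Fin m × Fin n) := fun d =>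
    if e d.1.1.1 d.1.1.2 ∈ V ∧ (e d.1.1.2 d.1.1.1 ∈ V → d.2 ∈ A d.1.1.1 d.1.1.2) then
      eBlock d.1.1.1 d.1.1.2 d.2 else eBlock d.1.1.2 d.1.1.1 d.2⁻¹
  have hw : setW V A B ⊆ Set.range w := by
    rintro x (hx | hx)
    · obtain ⟨⟨i, j⟩, ⟨hij, h1, h2⟩, f, rfl⟩ := Set.mem_iUnion₂.1 hx
      simp only at hij h1 h2
      rcases lt_or_gt_of_ne hij with h | h
      · exact ⟨(⟨(i, j), h⟩, f), if_pos ⟨h1, fun h => absurd h h2⟩⟩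
      · refine ⟨(⟨(j, i), h⟩, f⁻¹), ?_⟩
        simp [w, h2]
    · obtain ⟨⟨i, j⟩, hij, ⟨f, hf, rfl⟩ | ⟨f, hf, rfl⟩⟩ := Set.mem_iUnion₂.1 hx
      · exact ⟨(⟨(i, j), hij.1⟩, f), if_pos ⟨hij.2.1, fun _ => hf⟩⟩
      · refine ⟨(⟨(i, j), hij.1⟩, f), if_neg fun h => ?_⟩
        exact Set.disjoint_left.1 (hAB i j hij) (h.2 hij.2.2) hf
  refine (Set.encard_le_encard hw).trans ((encard_range_le w).trans (le_of_eq ?_))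
  rw [Fintype.card_prod, card_ordPair, Fintype.card_perm, Fintype.card_fin, mul_comm]

theorem isIdemGenSet_union_setW {m n : ℕ} (hn : 0 < n) {U : Fin m → Set (Function.End (Fin n))}
    {V : Set (Function.End (Fin m))} {A B : Fin m → Fin m → Set (Equiv.Perm (Fin n))}
    (hU : ∀ i, IsIdemGenSet (idemGen (Fin n)) (U i)) (hV : V ⊆ idemCorankOne m)
    (hgen : (Subsemigroup.closure V : Set (Function.End (Fin m))) = singular m)
    (hAB : ∀ i j, (i, j) ∈ Xi V → (A i j).Nonempty ∧ (B i j).Nonempty ∧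
      Disjoint (A i j) (B i j) ∧ A i j ∪ B i j = Set.univ) :
    IsIdemGenSet (idemGenPreserving (blocks m n)) ((⋃ i, inBlock i '' U i) ∪ setW V A B) := by
  have hidem : ∀ u ∈ (⋃ i, inBlock i '' U i) ∪ setW V A B,
      u ∈ preserving (blocks m n) ∧ IsIdempotentElem u := by
    rintro u (hu | hu | hu)
    · obtain ⟨i, v, hv, rfl⟩ := Set.mem_iUnion.1 hu
      exact ⟨wr_mem_preserving _ _, IsIdempotentElem.map ((hU i).1 v hv) (inBlockHom n i)⟩
    · obtain ⟨p, hp, f, rfl⟩ := Set.mem_iUnion₂.1 hu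
      exact ⟨wr_mem_preserving _ _, eBlock_idem hp.1 f⟩
    · obtain ⟨p, hp, ⟨f, -, rfl⟩ | ⟨f, -, rfl⟩⟩ := Set.mem_iUnion₂.1 hu
      · exact ⟨wr_mem_preserving _ _, eBlock_idem hp.1.ne f⟩
      · exact ⟨wr_mem_preserving _ _, eBlock_idem hp.1.ne' _⟩
  refine ⟨fun u hu => (hidem u hu).2, le_antisymm (Submonoid.closure_mono hidem) ?_⟩
  set M := Submonoid.closure ((⋃ i, inBlock i '' U i) ∪ setW V A B) with hM
  refine idemGenPreserving_le hn (fun i g hg => ?_) fun i j hij f => ?_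
  · have hle : Submonoid.closure (U i) ≤ M.comap (inBlockHom n i) :=
      Submonoid.closure_le.2 fun v hv =>
        Submonoid.subset_closure (Or.inl (Set.mem_iUnion.2 ⟨i, v, hv, rfl⟩))
    have hcl : Submonoid.closure (U i) = idemGen (Fin n) := (hU i).2
    exact hle (hcl ▸ hg)
  · exact eBlock_mem_of_setW_subset hV hgen hAB
      (Set.subset_union_right.trans Submonoid.subset_closure) hij f

theorem encard_union_setW_le {m n : ℕ} (hn : 2 ≤ n) {U : Fin m → Set (Function.End (Fin n))}
    {V : Set (Function.End (Fin m))} {A B : Fin m → Fin m → Set (Equiv.Perm (Fin n))}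
    (hU : ∀ i, IsMinIdemGenSet (idemGen (Fin n)) (U i))
    (hAB : ∀ i j, (i, j) ∈ Xi V → Disjoint (A i j) (B i j)) :
    ((⋃ i, inBlock i '' U i) ∪ setW V A B).encard ≤
      ((m * rho n + n.factorial * m.choose 2 : ℕ) : ℕ∞) := by
  have h1 : (⋃ i, inBlock (n := n) i '' U i).encard ≤ ((m * rho n : ℕ) : ℕ∞) := by
    refine (Set.encard_iUnion_le_of_fintype _).trans ?_
    calc ∑ i, (inBlock (n := n) i '' U i).encard ≤ ∑ _i : Fin m, (rho n : ℕ∞) :=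
          Finset.sum_le_sum fun i _ =>
            (Set.encard_image_le _ _).trans (encard_le_rho_of_isMinIdemGenSet hn (hU i))
      _ = ((m * rho n : ℕ) : ℕ∞) := by simp
  rw [Nat.cast_add]
  exact (Set.encard_union_le _ _).trans (add_le_add h1 (setW_encard_le hAB))

end BlockTransf

theorem theorem4p7 (m n : ℕ) (hm : 2 ≤ m) (hn : 2 ≤ n) :
    (∀ (U : Fin m → Set (Function.End (Fin n)))
        (V : Set (Function.End (Fin m)))
        (A B : Fin m → Fin m → Set (Equiv.Perm (Fin n))),
      (∀ i, BlockTransf.IsMinIdemGenSet (BlockTransf.idemGen (Fin n)) (U i)) →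
      V ⊆ BlockTransf.idemCorankOne m →
      (Subsemigroup.closure V : Set (Function.End (Fin m))) = BlockTransf.singular m →
      (∀ i j, (i, j) ∈ BlockTransf.Xi V →
        (A i j).Nonempty ∧ (B i j).Nonempty ∧ Disjoint (A i j) (B i j) ∧
          A i j ∪ B i j = Set.univ) →
      BlockTransf.IsIdemGenSet (BlockTransf.idemGenPreserving (BlockTransf.blocks m n))
        ((⋃ i, BlockTransf.inBlock i '' U i) ∪ BlockTransf.setW V A B) ∧
      ((⋃ i, BlockTransf.inBlock i '' U i) ∪ BlockTransf.setW V A B).encard =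
        ((m * BlockTransf.rho n + n.factorial * m.choose 2 : ℕ) : ℕ∞)) ∧
    BlockTransf.rank (BlockTransf.idemGenPreserving (BlockTransf.blocks m n)) =
      ((m * BlockTransf.rho n + n.factorial * m.choose 2 : ℕ) : ℕ∞) ∧
    BlockTransf.idrank (BlockTransf.idemGenPreserving (BlockTransf.blocks m n)) =
      ((m * BlockTransf.rho n + n.factorial * m.choose 2 : ℕ) : ℕ∞) := by
  have main : ∀ (U : Fin m → Set (Function.End (Fin n)))
        (V : Set (Function.End (Fin m)))
        (A B : Fin m → Fin m → Set (Equiv.Perm (Fin n))),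
      (∀ i, BlockTransf.IsMinIdemGenSet (BlockTransf.idemGen (Fin n)) (U i)) →
      V ⊆ BlockTransf.idemCorankOne m →
      (Subsemigroup.closure V : Set (Function.End (Fin m))) = BlockTransf.singular m →
      (∀ i j, (i, j) ∈ BlockTransf.Xi V →
        (A i j).Nonempty ∧ (B i j).Nonempty ∧ Disjoint (A i j) (B i j) ∧
          A i j ∪ B i j = Set.univ) →
      BlockTransf.IsIdemGenSet (BlockTransf.idemGenPreserving (BlockTransf.blocks m n))
        ((⋃ i, BlockTransf.inBlock i '' U i) ∪ BlockTransf.setW V A B) ∧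
      ((⋃ i, BlockTransf.inBlock i '' U i) ∪ BlockTransf.setW V A B).encard =
        ((m * BlockTransf.rho n + n.factorial * m.choose 2 : ℕ) : ℕ∞) := by
    intro U V A B hU hV hgen hAB
    have h := BlockTransf.isIdemGenSet_union_setW (by omega) (fun i => (hU i).1) hV hgen hAB
    exact ⟨h, le_antisymm (BlockTransf.encard_union_setW_le hn hU fun i j hij => (hAB i j hij).2.2.1)
      (h.2.le_encard hn)⟩
  obtain ⟨U, hU⟩ := BlockTransf.exists_isMinIdemGenSet hn
  have : Nontrivial (Fin n) := Fin.nontrivial_iff_two_le.2 hn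
  -- The ranks need one admissible choice of data. Here `{1}ᶜ` is non-empty because `2 ≤ n` provides
  -- a nontrivial permutation.
  obtain ⟨hgen, hcard⟩ := main (fun _ => U) (BlockTransf.elemIdem m) (fun _ _ => {1})
    (fun _ _ => {1}ᶜ) (fun _ => hU) (BlockTransf.elemIdem_subset_idemCorankOne m)
    (BlockTransf.closure_elemIdem m) fun i j _ =>
      ⟨Set.singleton_nonempty _, exists_ne 1, disjoint_compl_right, Set.union_compl_self _⟩
  refine ⟨main, le_antisymm ?_ ?_, le_antisymm ?_ ?_⟩
  · exact hcard ▸ iInf₂_le _ hgen.2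
  · exact le_iInf₂ fun G hG => BlockTransf.IsGenSet.le_encard hn hG
  · exact hcard ▸ iInf₂_le _ hgen
  · exact le_iInf₂ fun G hG => BlockTransf.IsGenSet.le_encard hn hG.2
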